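/- **Theorem 2 (Concurrence bounds).** Let $\Lambda$ be a qubit channel, i.e. a completely positive trace-preserving linear map on the complex $2\times 2$ matrices. Consider the numbers $p\in[0,1]$ for which there are a finite Kraus decomposition $\Lambda[\rho]=\sum_{i=1}^n A_i\rho A_i^\dagger$, a probability distribution $(q_i)_{i=1}^n$ and operators $\tilde A_i$ with $\|\tilde A_i\|_\infty\le 1$ (largest singular value) such that $\sqrt{q_i}\,\tilde A_i=\sqrt{p}\,A_i$ for all $i$. Among these numbers there is a largest one, the optimal probability of success $p_{\mathrm{succ}}(\Lambda)$ (of realizing $\Lambda$ by switching at random, with probabilities $q_i$, between postselected networks that implement the single Kraus operators $\tilde A_i$). Let $$J(\Lambda)=\frac12\sum_{i,j=1}^{2}\Lambda(|i\rangle\langle j|)\otimes|i\rangle\langle j|$$ be the Choi–Jamiołkowski state of $\Lambda$, let $\tilde J(\Lambda)=(\sigma_y\otimes\sigma_y)\,J(\Lambda)^{*}\,(\sigma_y\otimes\sigma_y)$ be its spin-flipped state, where ${}^*$ is entrywise complex conjugation in the computational basis and $\sigma_y=\begin{pmatrix}0&-i\\ i&0\end{pmatrix}$, and let $F=F(J(\Lambda),\tilde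 J(\Lambda))$, where $F(\sigma,\tau)=\operatorname{Tr}\sqrt{\sqrt{\sigma}\,\tau\sqrt{\sigma}}$ is the fidelity. Then $$\frac{1}{2-F}\;\ge\;p_{\mathrm{succ}}(\Lambda)\;\ge\;\frac{1}{1+\sqrt{1-F^{2}}}.$$ -/

import Mathlib

open scoped Matrix Kronecker ComplexOrder MatrixOrder Matrix.Norms.L2Operator CStarAlgebra

noncomputable section

namespace ChannelRealization

/-- Operators on a `d`-dimensional system, as matrices in the computational basis.  The norm `‖A‖`
on them is the `ℓ²` operator norm, that is, the largest singular value of `A`, and `A ≤ B` means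
that `B - A` is positive semidefinite. -/
abbrev Op (d : ℕ) : Type := Matrix (Fin d) (Fin d) ℂ

/-- A quantum channel on a `d`-dimensional system: a completely positive trace-preserving
linear map. -/
structure QuantumChannel (d : ℕ) extends Op d →CP Op d where
  trace_preserving : ∀ ρ : Op d, (toFun ρ).trace = ρ.trace

/-- The action of a channel on operators. -/
instance (d : ℕ) : CoeFun (QuantumChannel d) (fun _ => Op d → Op d) where
  coe Λ := Λ.toFun

/-- `A₁, …, Aₙ` is a Kraus decomposition of `Λ`: `Λ[ρ] = ∑ᵢ Aᵢ ρ Aᵢ†`.  (The completeness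
relation `∑ᵢ Aᵢ† Aᵢ = 1` is then automatic, as `Λ` preserves the trace.) -/
def IsKrausDecomposition {d n : ℕ} (Λ : QuantumChannel d) (A : Fin n → Op d) : Prop :=
  ∀ ρ : Op d, Λ ρ = ∑ i, A i * ρ * (A i)ᴴ

/-- The probabilities `p` with which the channel `Λ` can be realized exactly by randomly switching
between postselected single-Kraus-operator networks: for some Kraus decomposition `{Aᵢ}` of `Λ`,
the `i`-th network is chosen with probability `qᵢ` and implements an admissible Kraus operator
`Aᵢ'` (one with `‖Aᵢ'‖ ≤ 1`), where `√qᵢ Aᵢ' = √p Aᵢ` for all `i`. -/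
def successProbabilities {d : ℕ} (Λ : QuantumChannel d) : Set ℝ :=
  {p | 0 ≤ p ∧ p ≤ 1 ∧ ∃ (n : ℕ) (A A' : Fin n → Op d) (q : Fin n → ℝ),
    IsKrausDecomposition Λ A ∧
    (∀ i, 0 ≤ q i) ∧ ∑ i, q i = 1 ∧
    (∀ i, ‖A' i‖ ≤ 1) ∧
    ∀ i, √(q i) • A' i = √p • A i}

/-- The optimal probability of success `p_succ(Λ)`. -/
def pSucc {d : ℕ} (Λ : QuantumChannel d) : ℝ :=
  sSup (successProbabilities Λ)

/-- The Choi–Jamiołkowski state `J(Λ) = (1/d) ∑ᵢⱼ Λ(|i⟩⟨j|) ⊗ |i⟩⟨j|`. -/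
def choiState {d : ℕ} (Λ : QuantumChannel d) : Matrix (Fin d × Fin d) (Fin d × Fin d) ℂ :=
  (1 / (d : ℂ)) • ∑ i : Fin d, ∑ j : Fin d,
    Λ (Matrix.single i j (1 : ℂ)) ⊗ₖ Matrix.single i j (1 : ℂ)

/-- The Pauli matrix `σ_y`. -/
def pauliY : Op 2 :=
  !![0, -Complex.I; Complex.I, 0]

/-- The spin-flipped two-qubit operator `ρ̃ = (σ_y ⊗ σ_y) ρ* (σ_y ⊗ σ_y)`, where `ρ*` is the
entrywise complex conjugate in the computational basis. -/
def spinFlip (ρ : Matrix (Fin 2 × Fin 2) (Fin 2 × Fin 2) ℂ) :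
    Matrix (Fin 2 × Fin 2) (Fin 2 × Fin 2) ℂ :=
  (pauliY ⊗ₖ pauliY) * ρ.map star * (pauliY ⊗ₖ pauliY)

/-- The fidelity `F(σ, τ) = Tr √(√σ τ √σ)` of positive semidefinite matrices, with `CFC.sqrt` the
positive semidefinite square root.  (The trace is a nonnegative real number.) -/
def fidelity {m : Type*} [Fintype m] [DecidableEq m] (σ τ : Matrix m m ℂ) : ℝ :=
  (CFC.sqrt (CFC.sqrt σ * τ * CFC.sqrt σ)).trace.re

end ChannelRealization

end

/-!
Realizing `Λ` through a Kraus decomposition `A` succeeds at best with probability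
`1 / ∑ᵢ ‖A i‖ ^ 2`, where the networks are chosen with probabilities proportional to `‖A i‖ ^ 2`
(`inv_sum_norm_sq_mem_successProbabilities`, `mul_sum_norm_sq_le_one`).  If `a i ≥ b i` are the
singular values of the `2 × 2` matrix `A i`, then `‖A i‖ = a i`, `|det (A i)| = a i * b i`, and
`∑ᵢ (a i ^ 2 + b i ^ 2) = 2` by trace preservation.  Hence
`2 - δ ≤ ∑ᵢ ‖A i‖ ^ 2 ≤ 1 + √(1 - δ ^ 2)` with `δ = ∑ᵢ |det (A i)|`
(`IsKrausDecomposition.sum_norm_sq_bounds`).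

Kraus decompositions of `Λ` are the decompositions of the Choi state `J` into rank-one matrices, and
`|det (A i)|` is the concurrence of the corresponding vector.  The fidelity `F` is the concurrence of
assistance, that is, the largest possible value of `δ`: it bounds `δ` for every decomposition
(`IsKrausDecomposition.sum_norm_det_le`) and is attained by one of them
(`exists_isKrausDecomposition_sum_norm_det_eq`).  The first fact gives the upper bound on the success
probability, the second one the lower bound and `F ≤ 1`.

With `T = √J S (√J)ᵀ`, `S = σ_y ⊗ σ_y`, one has `F = Tr √(T Tᴴ)`, the trace norm of a symmetric
matrix.  Both facts about `F` come from a family of unit vectors `z k` with `T z̄ k = l k • z k`, `l k`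
real, and `∑ₖ z k (z k)† = 2`, which the real spectral theorem for the antilinear map `z ↦ T z̄`
provides (`exists_tightFrame_of_isSymm`); then `F = ½ ∑ₖ |l k|` (`trace_sqrt_mul_conjTranspose`).

The optimum is attained because the success probabilities are described by the convex hull of a
compact set in a finite-dimensional space (`isCompact_admissibleHull`).
-/

noncomputable section

namespace ChannelRealization

/-! ### Convex hulls of compact sets -/

/-- By Carathéodory's theorem, convex combinations of `finrank ℝ E + 1` points suffice, so the hull
is a continuous image of a product of a simplex and copies of `s`. -/
theorem isCompact_convexHull_of_finiteDimensional {E : Type*} [AddCommGroup E] [Module ℝ E]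
    [TopologicalSpace E] [ContinuousAdd E] [ContinuousSMul ℝ E] [FiniteDimensional ℝ E]
    {s : Set E} (hs : IsCompact s) : IsCompact (convexHull ℝ s) := by
  rcases s.eq_empty_or_nonempty with rfl | ⟨x₀, hx₀⟩
  · simp
  set N := Module.finrank ℝ E + 1
  let f : (Fin N → ℝ) × (Fin N → E) → E := fun v => ∑ i, v.1 i • v.2 i
  have hf : Continuous f := by fun_prop
  have hK := ((isCompact_stdSimplex ℝ (Fin N)).prod
    (isCompact_univ_pi (fun _ : Fin N => hs))).image hf
  convert hK using 1
  refine subset_antisymm (fun x hx => ?_) ?_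
  · obtain ⟨ι, _, z, w, hz, hind, hw, hw1, rfl⟩ := eq_pos_convex_span_of_mem_convexHull hx
    have hcard : Fintype.card ι ≤ Fintype.card (Fin N) := by
      simpa [N] using hind.card_le_finrank_succ.trans
        (Nat.succ_le_succ (Submodule.finrank_le _))
    obtain ⟨e⟩ := Function.Embedding.nonempty_of_card_le hcard
    refine ⟨(Function.extend e w 0, Function.extend e z fun _ => x₀), ⟨⟨fun i => ?_, ?_⟩, ?_⟩, ?_⟩
    · by_cases hi : ∃ j, e j = i
      · obtain ⟨j, rfl⟩ := hi
        simpa [e.injective.extend_apply] using (hw j).le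
      · simp [Function.extend_apply' _ _ _ hi]
    · dsimp only
      rw [← hw1]
      exact (Fintype.sum_of_injective e e.injective _ _
        (fun i hi => by simp [Function.extend_apply' _ _ _ hi])
        fun i => by simp [e.injective.extend_apply]).symm
    · intro i _
      by_cases hi : ∃ j, e j = i
      · obtain ⟨j, rfl⟩ := hi
        simpa [e.injective.extend_apply] using hz ⟨j, rfl⟩
      · simpa [Function.extend_apply' _ _ _ hi] using hx₀
    · simp only [f]
      exact (Fintype.sum_of_injective e e.injective _ _
        (fun i hi => by simp [Function.extend_apply' _ _ _ hi])
        fun i => by simp [e.injective.extend_apply]).symm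
  · rintro _ ⟨⟨w, z⟩, ⟨hw, hz⟩, rfl⟩
    exact (convex_convexHull ℝ s).sum_mem (fun i _ => hw.1 i) hw.2
      fun i _ => subset_convexHull ℝ s (hz i trivial)

/-! ### Symmetric complex matrices and tight frames -/

/-- A replacement for the Autonne–Takagi factorization.  For `T = X + iY` symmetric, the real
matrix `[X, Y; Y, -X]` is the matrix of the antilinear map `z ↦ T z̄` on `ℂᵐ = ℝᵐ ⊕ iℝᵐ`; it is
symmetric, and a real orthonormal eigenbasis of it is a family of unit vectors `z k` in `ℂᵐ` with
`∑ₖ z k (z k)† = 2`.  The `l k` may be negative: `i z` belongs to `-l` if `z` belongs to `l`. -/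
theorem exists_tightFrame_of_isSymm {m : Type*} [Fintype m] [DecidableEq m] {T : Matrix m m ℂ}
    (hT : T.IsSymm) :
    ∃ (z : m ⊕ m → m → ℂ) (l : m ⊕ m → ℝ), (∀ k, T *ᵥ star (z k) = (l k : ℂ) • z k) ∧
      (∀ k, star (z k) ⬝ᵥ z k = 1) ∧ ∑ k, Matrix.vecMulVec (z k) (star (z k)) = (2 : ℂ) • 1 := by
  set X : Matrix m m ℝ := T.map Complex.re with hX
  set Y : Matrix m m ℝ := T.map Complex.im with hY
  have hXs : Xᵀ = X := by rw [hX, ← Matrix.transpose_map, hT.eq]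
  have hYs : Yᵀ = Y := by rw [hY, ← Matrix.transpose_map, hT.eq]
  have hB : (Matrix.fromBlocks X Y Y (-X)).IsHermitian := by
    rw [Matrix.IsHermitian, Matrix.conjTranspose_eq_transpose_of_trivial,
      Matrix.fromBlocks_transpose]
    simp [hXs, hYs]
  set u := hB.eigenvectorBasis
  -- the rows of the orthogonal matrix of eigenvectors are orthonormal
  have hon : ∀ i j, ∑ k, u k i * u k j = if i = j then 1 else 0 := by
    intro i j
    have h := congrFun (congrFun (Unitary.coe_mul_star_self hB.eigenvectorUnitary) i) j
    simpa [Matrix.mul_apply, Matrix.one_apply, Matrix.star_apply,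
      Matrix.IsHermitian.eigenvectorUnitary_apply] using h
  refine ⟨fun k a => ⟨u k (Sum.inl a), u k (Sum.inr a)⟩, hB.eigenvalues, fun k => ?_,
    fun k => ?_, ?_⟩
  · have h := hB.mulVec_eigenvectorBasis k
    ext a
    have h1 := congrFun h (Sum.inl a)
    have h2 := congrFun h (Sum.inr a)
    simp [Matrix.mulVec, dotProduct, Fintype.sum_sum_type, X, Y] at h1 h2
    apply Complex.ext
    · simp [Matrix.mulVec, dotProduct, Finset.sum_add_distrib]
      exact h1
    · simp [Matrix.mulVec, dotProduct, Finset.sum_add_distrib]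
      linarith
  · have h := u.orthonormal.1 k
    have h' : ∑ i, u k i * u k i = 1 := by
      have := EuclideanSpace.real_norm_sq_eq (u k)
      rw [h] at this
      simpa [← sq] using this.symm
    rw [Fintype.sum_sum_type] at h'
    apply Complex.ext
    · simpa [dotProduct, Finset.sum_add_distrib] using h'
    · simp [dotProduct]
      exact Finset.sum_eq_zero fun i _ => by ring
  · ext a b
    have h1 := hon (Sum.inl a) (Sum.inl b)
    have h2 := hon (Sum.inr a) (Sum.inr b)
    have h3 := hon (Sum.inr a) (Sum.inl b)
    have h4 := hon (Sum.inl a) (Sum.inr b)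
    simp only [Sum.inl.injEq, Sum.inr.injEq, reduceCtorEq, if_false] at h1 h2 h3 h4
    rw [Matrix.sum_apply]
    apply Complex.ext
    · simp only [Matrix.vecMulVec_apply, Complex.re_sum, Pi.star_apply, RCLike.star_def,
        Complex.mul_re, Complex.conj_re, Complex.conj_im, mul_neg, sub_neg_eq_add,
        Finset.sum_add_distrib, h1, h2]
      by_cases hab : a = b <;> simp [hab]; norm_num
    · simp only [Matrix.vecMulVec_apply, Complex.im_sum, Pi.star_apply, RCLike.star_def,
        Complex.mul_im, Complex.conj_re, Complex.conj_im, mul_neg,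
        Finset.sum_add_distrib, Finset.sum_neg_distrib, h3, h4]
      by_cases hab : a = b <;> simp [hab]

theorem _root_.Matrix.PosSemidef.mulVec_eq_of_sq_mulVec_eq {m : Type*} [Fintype m]
    {P : Matrix m m ℂ} (hP : P.PosSemidef) {z : m → ℂ} {r : ℝ} (hr : 0 ≤ r)
    (h : P *ᵥ (P *ᵥ z) = ((r : ℂ) ^ 2) • z) : P *ᵥ z = (r : ℂ) • z := by
  -- `(P + r) (P - r) z = 0`, and `P + r` is injective unless `r = 0`
  set y := P *ᵥ z - (r : ℂ) • z with hy
  have hPy : P *ᵥ y = -(r : ℂ) • y := by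
    rw [hy, Matrix.mulVec_sub, h, Matrix.mulVec_smul]
    module
  rcases hr.eq_or_lt with rfl | hr
  · have h0 : star (P *ᵥ z) ⬝ᵥ (P *ᵥ z) = 0 := by
      rw [Matrix.star_mulVec, hP.1.eq, ← Matrix.dotProduct_mulVec, h]
      simp
    simpa using dotProduct_star_self_eq_zero.1 h0
  · have h1 := hP.dotProduct_mulVec_nonneg y
    rw [hPy, dotProduct_smul, smul_eq_mul] at h1
    have h2 : 0 ≤ star y ⬝ᵥ y := dotProduct_star_self_nonneg y
    have h3 : star y ⬝ᵥ y = 0 := by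
      refine le_antisymm ?_ h2
      have : (0:ℂ) < r := by exact_mod_cast hr
      by_contra hc
      have h5 : 0 < star y ⬝ᵥ y := lt_of_le_of_ne h2 fun h => hc h.symm.le
      have := mul_pos this h5
      rw [neg_mul, Left.nonneg_neg_iff] at h1
      exact absurd (this.trans_le h1) (lt_irrefl _)
    have : y = 0 := dotProduct_star_self_eq_zero.1 h3
    exact sub_eq_zero.1 this

/-- The frame vectors of `exists_tightFrame_of_isSymm` are eigenvectors of `√(T Tᴴ)` for the
eigenvalues `|l k|`, so that they compute the trace norm of `T`. -/
theorem trace_sqrt_mul_conjTranspose {m : Type*} [Fintype m] [DecidableEq m] {T : Matrix m m ℂ}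
    (hT : T.IsSymm) {ι : Type*} [Fintype ι] {z : ι → m → ℂ} {l : ι → ℝ}
    (hz : ∀ k, T *ᵥ star (z k) = (l k : ℂ) • z k) (hz1 : ∀ k, star (z k) ⬝ᵥ z k = 1)
    (hsum : ∑ k, Matrix.vecMulVec (z k) (star (z k)) = (2 : ℂ) • 1) :
    (CFC.sqrt (T * Tᴴ)).trace.re = (∑ k, |l k|) / 2 := by
  set P := CFC.sqrt (T * Tᴴ)
  have hP : P.PosSemidef := Matrix.nonneg_iff_posSemidef.1 (CFC.sqrt_nonneg _)
  have hPP : P * P = T * Tᴴ :=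
    CFC.sqrt_mul_sqrt_self _ (Matrix.posSemidef_self_mul_conjTranspose T).nonneg
  have hPz : ∀ k, P *ᵥ z k = ((|l k| : ℝ) : ℂ) • z k := by
    intro k
    refine hP.mulVec_eq_of_sq_mulVec_eq (abs_nonneg _) ?_
    have h1 : Tᴴ *ᵥ z k = (l k : ℂ) • star (z k) := by
      have h := congrArg star (hz k)
      rw [Matrix.star_mulVec, star_star, ← Matrix.mulVec_transpose, Matrix.conjTranspose,
        Matrix.transpose_map, Matrix.transpose_transpose] at h
      rw [Matrix.conjTranspose, hT.eq, h]
      simp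
    rw [Matrix.mulVec_mulVec, hPP, ← Matrix.mulVec_mulVec, h1, Matrix.mulVec_smul, hz, smul_smul]
    congr 1
    rw [← Complex.ofReal_pow, sq_abs]
    push_cast; ring
  have h2 : (2 : ℂ) * P.trace = ∑ k, ((|l k| : ℝ) : ℂ) := by
    have : ((2 : ℂ) • P).trace = (P * ((2 : ℂ) • 1)).trace := by simp
    rw [← smul_eq_mul, ← Matrix.trace_smul, this, ← hsum, Matrix.mul_sum, Matrix.trace_sum]
    refine Finset.sum_congr rfl fun k _ => ?_
    rw [Matrix.mul_vecMulVec, hPz, Matrix.trace_vecMulVec, smul_dotProduct, dotProduct_comm, hz1]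
    simp
  have h3 := congrArg Complex.re h2
  rw [← Complex.ofReal_sum] at h3
  simp at h3
  linarith

/-! ### Fidelity with a spin-flipped state -/

section SpinFlip

variable {m : Type*} [Fintype m] [DecidableEq m]

/-- Any decomposition of `J` into rank-one matrices comes from vectors `y i` through `√J`, with
`∑ᵢ y i (y i)† ≤ 1`.  Here `y i` is `w i` multiplied by the pseudo-inverse of `√J`. -/
theorem exists_sqrt_mulVec_eq {J : Matrix m m ℂ} (hJ : J.PosSemidef) {ι : Type*} [Fintype ι]
    {w : ι → m → ℂ} (hw : J = ∑ i, Matrix.vecMulVec (w i) (star (w i))) :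
    ∃ y : ι → m → ℂ, (∀ i, CFC.sqrt J *ᵥ y i = w i) ∧
      ∀ z : m → ℂ, ∑ i, ‖star (y i) ⬝ᵥ z‖ ^ 2 ≤ (star z ⬝ᵥ z).re := by
  have hJs : IsSelfAdjoint J := hJ.1
  have hcont : ∀ f : ℝ → ℝ, ContinuousOn f (spectrum ℝ J) := fun f =>
    (Matrix.finite_real_spectrum (A := J)).continuousOn f
  have hpos : ∀ x ∈ spectrum ℝ J, 0 ≤ x := fun x hx => spectrum_nonneg_of_nonneg hJ.nonneg hx
  have hR : CFC.sqrt J = cfc Real.sqrt J := by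
    rw [CFC.sqrt_eq_real_sqrt _ hJ.nonneg, cfcₙ_eq_cfc]
  -- `G` is the pseudo-inverse of `√J`, as `0⁻¹ = 0`, and `P` the projection onto the range of `J`
  set G := cfc (fun x : ℝ => (√x)⁻¹) J with hG
  set P := cfc (fun x : ℝ => if x = 0 then (0:ℝ) else 1) J with hP
  have hGs : Gᴴ = G := cfc_predicate (p := IsSelfAdjoint) (fun x : ℝ => (√x)⁻¹) J
  have hPs : Pᴴ = P :=
    cfc_predicate (p := IsSelfAdjoint) (fun x : ℝ => if x = 0 then (0:ℝ) else 1) J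
  have hRG : CFC.sqrt J * G = P := by
    rw [hR, hG, hP, ← cfc_mul _ _ J (hcont _) (hcont _)]
    refine cfc_congr fun x hx => ?_
    by_cases h0 : x = 0
    · simp [h0]
    · have := Real.sqrt_pos.2 ((hpos x hx).lt_of_ne' h0)
      simp [h0, this.ne']
  have hPP : P * P = P := by
    rw [hP, ← cfc_mul _ _ J (hcont _) (hcont _)]
    exact cfc_congr fun x hx => by by_cases h0 : x = 0 <;> simp [h0]
  have hPJ : P * J = J := by
    conv_lhs => rw [← cfc_id' ℝ J, hP]
    rw [← cfc_mul _ _ J (hcont _) (hcont _)]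
    conv_rhs => rw [← cfc_id' ℝ J]
    exact cfc_congr fun x hx => by by_cases h0 : x = 0 <;> simp [h0]
  have hGJG : G * J * G = P := by
    conv_lhs => rw [← cfc_id' ℝ J, hG]
    rw [← cfc_mul _ _ J (hcont _) (hcont _), ← cfc_mul _ _ J (hcont _) (hcont _), hP]
    refine cfc_congr fun x hx => ?_
    by_cases h0 : x = 0
    · simp [h0]
    · have := Real.sqrt_pos.2 ((hpos x hx).lt_of_ne' h0)
      have h2 := Real.mul_self_sqrt (hpos x hx)
      simp only [h0, if_false]
      field_simp
      rw [sq, h2]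
  -- `∑ᵢ ((1 - P) wᵢ) ((1 - P) wᵢ)† = (1 - P) J (1 - P) = 0`, so every `(1 - P) wᵢ` vanishes
  have hPw : ∀ i, P *ᵥ w i = w i := by
    have h0 : (1 - P) * J * (1 - P)ᴴ = 0 := by rw [sub_mul, hPJ, one_mul, sub_self, zero_mul]
    have h1 : ∑ i, star ((1 - P) *ᵥ w i) ⬝ᵥ ((1 - P) *ᵥ w i) = 0 := by
      rw [hw, Finset.mul_sum, Finset.sum_mul] at h0
      have h2 := congrArg Matrix.trace h0
      rw [Matrix.trace_sum, Matrix.trace_zero] at h2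
      rw [← h2]
      refine Finset.sum_congr rfl fun i _ => ?_
      rw [Matrix.mul_vecMulVec, Matrix.vecMulVec_mul, ← Matrix.star_mulVec,
        Matrix.trace_vecMulVec, dotProduct_comm]
    intro i
    have h3 := (Finset.sum_eq_zero_iff_of_nonneg fun i _ => dotProduct_star_self_nonneg _).1 h1 i
      (Finset.mem_univ i)
    have h4 := dotProduct_star_self_eq_zero.1 h3
    rw [Matrix.sub_mulVec, Matrix.one_mulVec, sub_eq_zero] at h4
    exact h4.symm
  refine ⟨fun i => G *ᵥ w i, fun i => by rw [Matrix.mulVec_mulVec, hRG, hPw], fun z => ?_⟩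
  have h5 : ((∑ i, ‖star (G *ᵥ w i) ⬝ᵥ z‖ ^ 2 : ℝ) : ℂ) = star z ⬝ᵥ (P *ᵥ z) := by
    rw [← hGJG, hw, Finset.mul_sum, Finset.sum_mul, Matrix.sum_mulVec, dotProduct_sum]
    push_cast
    refine Finset.sum_congr rfl fun i _ => ?_
    rw [Matrix.mul_vecMulVec, Matrix.vecMulVec_mul, Matrix.vecMulVec_mulVec, dotProduct_smul,
      Matrix.star_mulVec, hGs, ← Complex.mul_conj', MulOpposite.smul_eq_mul_unop,
      MulOpposite.unop_op, mul_comm]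
    congr 1
    rw [← RCLike.star_def, Matrix.star_dotProduct, Matrix.star_mulVec, hGs]
  have h6 : 0 ≤ star z ⬝ᵥ ((1 - P) *ᵥ z) := by
    have : 1 - P = (1 - P)ᴴ * (1 - P) := by
      simp [hPs, sub_mul, mul_sub, hPP]
    rw [this]
    exact (Matrix.posSemidef_conjTranspose_mul_self _).dotProduct_mulVec_nonneg z
  rw [Matrix.sub_mulVec, Matrix.one_mulVec, dotProduct_sub, ← h5] at h6
  have h7 := (Complex.le_def.1 h6).1
  rw [Complex.sub_re, Complex.ofReal_re] at h7
  simpa using h7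

/-- The matrix `√J S (√J)ᵀ`.  It represents the antilinear map `w ↦ S w̄`, compressed by `√J` on
both sides: as `√J` is Hermitian, its transpose is its entrywise conjugate. -/
def conjugateBySqrt (J S : Matrix m m ℂ) : Matrix m m ℂ :=
  CFC.sqrt J * S * (CFC.sqrt J)ᵀ

theorem isSymm_conjugateBySqrt (J : Matrix m m ℂ) {S : Matrix m m ℂ} (hS : S.IsSymm) :
    (conjugateBySqrt J S).IsSymm := by
  simp [Matrix.IsSymm, conjugateBySqrt, Matrix.transpose_mul, hS.eq, Matrix.mul_assoc]

theorem isHermitian_sqrt (J : Matrix m m ℂ) : (CFC.sqrt J)ᴴ = CFC.sqrt J :=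
  (Matrix.nonneg_iff_posSemidef.1 (CFC.sqrt_nonneg J)).1

theorem fidelity_eq_trace_conjugateBySqrt {J S : Matrix m m ℂ} (hJ : J.PosSemidef)
    (hS : S.IsHermitian) :
    fidelity J (S * J.map star * S) =
      (CFC.sqrt (conjugateBySqrt J S * (conjugateBySqrt J S)ᴴ)).trace.re := by
  have h : J.map star = (CFC.sqrt J)ᵀ * (CFC.sqrt J)ᵀ := by
    rw [← Matrix.transpose_mul, CFC.sqrt_mul_sqrt_self _ hJ.nonneg]
    conv_rhs => rw [← hJ.1.eq]
    rfl
  have h' : ((CFC.sqrt J)ᵀ)ᴴ = (CFC.sqrt J)ᵀ := by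
    exact Matrix.IsHermitian.transpose (isHermitian_sqrt J)
  rw [fidelity, h, conjugateBySqrt, Matrix.conjTranspose_mul, Matrix.conjTranspose_mul, h',
    isHermitian_sqrt, hS.eq]
  simp only [Matrix.mul_assoc]

theorem star_sqrt_mulVec_dotProduct (J S : Matrix m m ℂ) (y : m → ℂ) :
    star (CFC.sqrt J *ᵥ y) ⬝ᵥ (S *ᵥ star (CFC.sqrt J *ᵥ y)) =
      star y ⬝ᵥ (conjugateBySqrt J S *ᵥ star y) := by
  rw [Matrix.star_mulVec, isHermitian_sqrt, conjugateBySqrt, ← Matrix.mulVec_mulVec,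
    ← Matrix.mulVec_mulVec, Matrix.mulVec_transpose, ← Matrix.dotProduct_mulVec]

/-- The fidelity of `J` and `S J* S` bounds the sum of the values `|⟨w i, S w̄ i⟩|` for every
decomposition of `J` into rank-one matrices. -/
theorem sum_norm_le_fidelity {J S : Matrix m m ℂ} (hJ : J.PosSemidef) (hS : S.IsHermitian)
    (hS' : S.IsSymm) {ι : Type*} [Fintype ι] {w : ι → m → ℂ}
    (hw : J = ∑ i, Matrix.vecMulVec (w i) (star (w i))) :
    ∑ i, ‖star (w i) ⬝ᵥ (S *ᵥ star (w i))‖ ≤ fidelity J (S * J.map star * S) := by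
  obtain ⟨z, l, hz, hz1, hsum⟩ :=
    exists_tightFrame_of_isSymm (isSymm_conjugateBySqrt J hS')
  obtain ⟨y, hy, hyb⟩ := exists_sqrt_mulVec_eq hJ hw
  rw [fidelity_eq_trace_conjugateBySqrt hJ hS,
    trace_sqrt_mul_conjTranspose (isSymm_conjugateBySqrt J hS') hz hz1 hsum]
  -- expand one of the two vectors in the tight frame
  have key : ∀ x : m → ℂ, (2 : ℂ) * (star x ⬝ᵥ (conjugateBySqrt J S *ᵥ star x)) =
      ∑ k, (l k : ℂ) * (star x ⬝ᵥ z k) ^ 2 := by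
    intro x
    have h1 : (2 : ℂ) • x = ∑ k, (star (z k) ⬝ᵥ x) • z k := by
      have := congrArg (· *ᵥ x) hsum
      simpa [Matrix.sum_mulVec, Matrix.vecMulVec_mulVec, Matrix.smul_mulVec,
        -Fintype.sum_sum_type] using this.symm
    have h2 : (2 : ℂ) • star x = ∑ k, (star x ⬝ᵥ z k) • star (z k) := by
      have := congrArg star h1
      rw [star_smul, star_sum, Complex.star_def, Complex.conj_ofNat] at this
      refine this.trans (Finset.sum_congr rfl fun k _ => ?_)
      rw [star_smul, ← Matrix.star_dotProduct]
    rw [← smul_eq_mul, ← dotProduct_smul, ← Matrix.mulVec_smul, h2, Matrix.mulVec_sum,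
      dotProduct_sum]
    refine Finset.sum_congr rfl fun k _ => ?_
    rw [Matrix.mulVec_smul, hz, dotProduct_smul, dotProduct_smul, smul_eq_mul, smul_eq_mul]
    ring
  have h3 : ∀ i, ‖star (w i) ⬝ᵥ (S *ᵥ star (w i))‖ ≤
      (∑ k, |l k| * ‖star (y i) ⬝ᵥ z k‖ ^ 2) / 2 := by
    intro i
    rw [← hy i, star_sqrt_mulVec_dotProduct]
    have h4 := congrArg norm (key (y i))
    rw [norm_mul] at h4
    have h5 := norm_sum_le Finset.univ fun k => (l k : ℂ) * (star (y i) ⬝ᵥ z k) ^ 2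
    simp only [norm_mul, norm_pow, Complex.norm_real, Real.norm_eq_abs] at h5
    rw [← h4] at h5
    rw [Complex.norm_ofNat] at h5
    linarith
  refine (Finset.sum_le_sum fun i _ => h3 i).trans ?_
  rw [← Finset.sum_div, Finset.sum_comm]
  gcongr with k
  rw [← Finset.mul_sum]
  refine mul_le_of_le_one_right (abs_nonneg _) ((hyb (z k)).trans ?_)
  simp [hz1]

/-- The bound of `sum_norm_le_fidelity` is attained, by the images `√J z k / √2` of the frame
vectors. -/
theorem exists_sum_norm_eq_fidelity {J S : Matrix m m ℂ} (hJ : J.PosSemidef)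
    (hS : S.IsHermitian) (hS' : S.IsSymm) :
    ∃ w : m ⊕ m → m → ℂ, J = ∑ i, Matrix.vecMulVec (w i) (star (w i)) ∧
      ∑ i, ‖star (w i) ⬝ᵥ (S *ᵥ star (w i))‖ = fidelity J (S * J.map star * S) := by
  obtain ⟨z, l, hz, hz1, hsum⟩ :=
    exists_tightFrame_of_isSymm (isSymm_conjugateBySqrt J hS')
  have hc : ((√2 : ℝ) : ℂ)⁻¹ * ((√2 : ℝ) : ℂ)⁻¹ = 2⁻¹ := by
    rw [← mul_inv, ← Complex.ofReal_mul, Real.mul_self_sqrt zero_le_two]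
    norm_num
  refine ⟨fun k => CFC.sqrt J *ᵥ (((√2 : ℝ) : ℂ)⁻¹ • z k), ?_, ?_⟩
  · have h1 : ∀ k, Matrix.vecMulVec (CFC.sqrt J *ᵥ (((√2 : ℝ) : ℂ)⁻¹ • z k))
        (star (CFC.sqrt J *ᵥ (((√2 : ℝ) : ℂ)⁻¹ • z k))) =
        CFC.sqrt J * ((2⁻¹ : ℂ) • Matrix.vecMulVec (z k) (star (z k))) * CFC.sqrt J := by
      intro k
      rw [Matrix.star_mulVec, isHermitian_sqrt, ← Matrix.mul_vecMulVec, ← Matrix.vecMulVec_mul,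
        ← Matrix.mul_assoc, star_smul, Matrix.smul_vecMulVec, Matrix.vecMulVec_smul, smul_smul,
        star_inv₀, RCLike.star_def, Complex.conj_ofReal, hc]
    simp_rw [h1]
    rw [← Finset.sum_mul, ← Finset.mul_sum, ← Finset.smul_sum, hsum, smul_smul]
    simp [CFC.sqrt_mul_sqrt_self _ hJ.nonneg]
  · rw [fidelity_eq_trace_conjugateBySqrt hJ hS,
      trace_sqrt_mul_conjTranspose (isSymm_conjugateBySqrt J hS') hz hz1 hsum, Finset.sum_div]
    refine Finset.sum_congr rfl fun k _ => ?_
    rw [star_sqrt_mulVec_dotProduct, star_smul, Matrix.mulVec_smul, hz, dotProduct_smul,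
      smul_dotProduct, dotProduct_smul, hz1, smul_eq_mul, smul_eq_mul, ← mul_assoc,
      star_inv₀, RCLike.star_def, Complex.conj_ofReal, hc]
    simp
    ring

end SpinFlip

/-! ### Singular values of a qubit operator -/

/-- The two singular values of a `2 × 2` matrix, expressed by the norm, the trace and the
determinant. -/
theorem exists_singularValues (A : Op 2) :
    ∃ a b : ℝ, 0 ≤ b ∧ b ≤ a ∧ ‖A‖ = a ∧ (Aᴴ * A).trace = ((a ^ 2 + b ^ 2 : ℝ) : ℂ) ∧
      ‖A.det‖ = a * b := by
  have hH := Matrix.posSemidef_conjTranspose_mul_self A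
  set e := hH.1.eigenvalues with he
  have h0 : ∀ i, 0 ≤ e i := hH.eigenvalues_nonneg
  have htr : (Aᴴ * A).trace = ((e 0 + e 1 : ℝ) : ℂ) := by
    rw [hH.1.trace_eq_sum_eigenvalues]; simp [he]
  have hdet : ‖A.det‖ ^ 2 = e 0 * e 1 := by
    have h1 := hH.1.det_eq_prod_eigenvalues
    have h2 : (Aᴴ * A).det = ((‖A.det‖ ^ 2 : ℝ) : ℂ) := by
      rw [Matrix.det_mul, Matrix.det_conjTranspose, RCLike.star_def, Complex.conj_mul']
      simp
    exact Complex.ofReal_injective (by rw [← h2, h1]; simp [he])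
  have hnorm : ‖A‖ ^ 2 = max (e 0) (e 1) := by
    rw [sq, ← CStarRing.norm_star_mul_self, Matrix.star_eq_conjTranspose]
    conv_lhs => rw [hH.1.spectral_theorem]
    rw [Unitary.conjStarAlgAut_apply, ← Unitary.coe_star, CStarRing.norm_mul_coe_unitary,
      CStarRing.norm_coe_unitary_mul, Matrix.l2_opNorm_diagonal, Pi.norm_def]
    simp [Fin.univ_succ, abs_of_nonneg (h0 _), ← he]
  have h2 : √(max (e 0) (e 1)) = ‖A‖ := by rw [← hnorm]; simp
  refine ⟨√(max (e 0) (e 1)), √(min (e 0) (e 1)), by positivity,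
    Real.sqrt_le_sqrt min_le_max, h2.symm, ?_, ?_⟩
  · rw [Real.sq_sqrt (le_max_of_le_left (h0 0)), Real.sq_sqrt (le_min (h0 0) (h0 1)),
      max_add_min, htr]
  · rw [← Real.sqrt_mul (le_max_of_le_left (h0 0)), max_mul_min, ← hdet]
    simp

/-! ### The Choi state and Kraus decompositions -/

/-- The vectorization of an operator: its matrix entries, as a vector of the two-partite system.
The row index comes first, as the channel acts on the first tensor factor of the Choi state. -/
def ket {d : ℕ} (A : Op d) : Fin d × Fin d → ℂ := fun x => A x.1 x.2

theorem choiState_apply {d : ℕ} (Λ : QuantumChannel d) (x y : Fin d × Fin d) :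
    choiState Λ x y = 1 / (d : ℂ) * Λ (Matrix.single x.2 y.2 1) x.1 y.1 := by
  obtain ⟨a, j⟩ := x
  obtain ⟨b, k⟩ := y
  simp [choiState, Matrix.sum_apply, Matrix.kroneckerMap_apply, Matrix.single_apply]
  left
  rw [Finset.sum_eq_single j]
  · rw [Finset.sum_eq_single k]
    · simp
    · intro i _ hi; simp [hi]
    · simp
  · intro i _ hi; simp [hi]
  · simp

theorem isKrausDecomposition_iff {d n : ℕ} (Λ : QuantumChannel d) (A : Fin n → Op d) :
    IsKrausDecomposition Λ A ↔
      (d : ℂ) • choiState Λ = ∑ i, Matrix.vecMulVec (ket (A i)) (star (ket (A i))) := by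
  have hentry : ∀ j k a b, (∑ i, A i * Matrix.single j k 1 * (A i)ᴴ : Op d) a b =
      (∑ i, Matrix.vecMulVec (ket (A i)) (star (ket (A i)))) (a, j) (b, k) := by
    intro j k a b
    rw [Matrix.sum_apply, Matrix.sum_apply]
    refine Finset.sum_congr rfl fun i _ => ?_
    simp [Matrix.mul_apply, Matrix.single_apply, ket, Matrix.vecMulVec_apply, ite_and]
  have hchoi : ∀ j k a b, Λ (Matrix.single j k 1) a b = ((d : ℂ) • choiState Λ) (a, j) (b, k) := by
    intro j k a b
    have hd : (d : ℂ) ≠ 0 := by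
      have := a.pos
      exact_mod_cast this.ne'
    rw [Matrix.smul_apply, choiState_apply, smul_eq_mul]
    field_simp
  constructor
  · intro h
    ext ⟨a, j⟩ ⟨b, k⟩
    rw [← hentry, ← hchoi, h]
  · intro h ρ
    let Φ : Op d →ₗ[ℂ] Op d :=
      ∑ i, LinearMap.mulLeftRight ℂ (A i, (A i)ᴴ)
    have hΦ : ∀ ρ, Φ ρ = ∑ i, A i * ρ * (A i)ᴴ := fun ρ => by simp [Φ]
    rw [← hΦ]
    have : Λ.toLinearMap = Φ := by
      refine Matrix.ext_linearMap ℂ fun j k => ?_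
      refine LinearMap.ext_ring ?_
      ext a b
      have h2 := (hchoi j k a b).trans ((congrFun (congrFun h (a, j)) (b, k)).trans
        (hentry j k a b).symm)
      rw [← hΦ] at h2
      exact h2
    exact congrArg (· ρ) this

/-- Complete positivity enters here: up to the factor `1 / d`, the Choi state is the image under `Λ`
of the positive block matrix `(|j⟩⟨k|)`, with the block index as second tensor factor. -/
theorem posSemidef_choiState {d : ℕ} (Λ : QuantumChannel d) : (choiState Λ).PosSemidef := by
  set M : CStarMatrix (Fin d) (Fin d) (Op d) :=
    CStarMatrix.ofMatrix (Matrix.of fun j k => Matrix.single j k 1)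
  have hM : 0 ≤ M := by
    rcases Nat.eq_zero_or_pos d with rfl | hd
    · exact (Subsingleton.elim 0 M).le
    -- `|j⟩⟨k| = |0⟩⟨j|† |0⟩⟨k|`, so that `M = N† N` for one row of blocks, padded by zeros
    let N : CStarMatrix (Fin d) (Fin d) (Op d) :=
      CStarMatrix.ofMatrix
        (Matrix.of fun l k => if l = ⟨0, hd⟩ then Matrix.single ⟨0, hd⟩ k 1 else 0)
    have : M = star N * N := by
      ext j k : 2
      rw [CStarMatrix.mul_apply, Finset.sum_eq_single ⟨0, hd⟩]
      · simp [M, N, CStarMatrix.star_apply, Matrix.star_eq_conjTranspose]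
      · intro l _ hl
        simp [N, hl]
      · simp
    rw [this]
    exact star_mul_self_nonneg N
  have h := Λ.map_cstarMatrix_nonneg' d M hM
  have key : ∀ X : CStarMatrix (Fin d) (Fin d) (Op d), 0 ≤ X →
      (Matrix.of fun x y : Fin d × Fin d => X x.2 y.2 x.1 y.1).PosSemidef := by
    intro X hX
    rw [StarOrderedRing.nonneg_iff] at hX
    induction hX using AddSubmonoid.closure_induction with
    | zero => exact Matrix.PosSemidef.zero
    | add X Y _ _ hX hY => exact hX.add hY
    | mem X hX =>
      obtain ⟨Y, rfl⟩ := hX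
      convert Matrix.posSemidef_conjTranspose_mul_self
        (Matrix.of fun x y : Fin d × Fin d => Y x.2 y.2 x.1 y.1) using 1
      ext ⟨a, j⟩ ⟨b, k⟩
      simp [CStarMatrix.mul_apply, Matrix.mul_apply, Matrix.sum_apply, Fintype.sum_prod_type,
        Matrix.star_apply, CStarMatrix.star_apply]
      exact Finset.sum_comm
  have h1 := key _ h
  have h2 : choiState Λ = (1 / (d : ℂ)) •
      (Matrix.of fun x y : Fin d × Fin d => (M.map Λ.toLinearMap) x.2 y.2 x.1 y.1) := by
    ext x y
    rw [choiState_apply]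
    rfl
  rw [h2]
  exact h1.smul (by positivity)

/-! ### The fidelity as concurrence of assistance -/

theorem isHermitian_pauliY : pauliY.IsHermitian := by
  ext i j
  fin_cases i <;> fin_cases j <;> simp [pauliY]

theorem isHermitian_pauliY_kronecker : (pauliY ⊗ₖ pauliY).IsHermitian := by
  rw [Matrix.IsHermitian, Matrix.conjTranspose_kronecker, isHermitian_pauliY.eq]

theorem isSymm_pauliY_kronecker : (pauliY ⊗ₖ pauliY).IsSymm := by
  have h : pauliYᵀ = -pauliY := by
    ext i j
    fin_cases i <;> fin_cases j <;> simp [pauliY]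
  ext ⟨a, b⟩ ⟨c, d⟩
  have h1 := congrFun (congrFun h a) c
  have h2 := congrFun (congrFun h b) d
  simp only [Matrix.transpose_apply, Matrix.neg_apply] at h1 h2
  simp [Matrix.kroneckerMap_apply, h1, h2]

/-- The concurrence of a vectorized operator is given by its determinant. -/
theorem norm_star_ket_dotProduct (A : Op 2) :
    ‖star (ket A) ⬝ᵥ ((pauliY ⊗ₖ pauliY) *ᵥ star (ket A))‖ = 2 * ‖A.det‖ := by
  have h : star (ket A) ⬝ᵥ ((pauliY ⊗ₖ pauliY) *ᵥ star (ket A)) = -2 * star A.det := by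
    simp [dotProduct, Matrix.mulVec, Fintype.sum_prod_type, Fin.sum_univ_two, ket, pauliY,
      Matrix.kroneckerMap_apply, Matrix.det_fin_two]
    ring
  rw [h, norm_mul, norm_star]
  simp

theorem vecMulVec_inv_sqrt_two_smul {m : Type*} (v : m → ℂ) :
    Matrix.vecMulVec (((√2 : ℝ) : ℂ)⁻¹ • v) (star (((√2 : ℝ) : ℂ)⁻¹ • v)) =
      (2⁻¹ : ℂ) • Matrix.vecMulVec v (star v) := by
  have hc : ((√2 : ℝ) : ℂ)⁻¹ * ((√2 : ℝ) : ℂ)⁻¹ = 2⁻¹ := by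
    rw [← mul_inv, ← Complex.ofReal_mul, Real.mul_self_sqrt zero_le_two]
    norm_num
  rw [star_smul, Matrix.smul_vecMulVec, Matrix.vecMulVec_smul, smul_smul, star_inv₀,
    RCLike.star_def, Complex.conj_ofReal, hc]

theorem norm_star_inv_sqrt_two_smul_ket (A : Op 2) :
    ‖star (((√2 : ℝ) : ℂ)⁻¹ • ket A) ⬝ᵥ
      ((pauliY ⊗ₖ pauliY) *ᵥ star (((√2 : ℝ) : ℂ)⁻¹ • ket A))‖ = ‖A.det‖ := by
  rw [star_smul, Matrix.mulVec_smul, dotProduct_smul, smul_dotProduct, smul_smul, smul_eq_mul,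
    norm_mul, norm_star_ket_dotProduct, norm_mul, norm_star, norm_inv, Complex.norm_real,
    Real.norm_of_nonneg (Real.sqrt_nonneg 2), ← mul_inv, Real.mul_self_sqrt zero_le_two]
  ring

theorem IsKrausDecomposition.sum_norm_det_le {n : ℕ} {Λ : QuantumChannel 2} {A : Fin n → Op 2}
    (hA : IsKrausDecomposition Λ A) :
    ∑ i, ‖(A i).det‖ ≤ fidelity (choiState Λ) (spinFlip (choiState Λ)) := by
  have h : choiState Λ = ∑ i, Matrix.vecMulVec (((√2 : ℝ) : ℂ)⁻¹ • ket (A i))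
      (star (((√2 : ℝ) : ℂ)⁻¹ • ket (A i))) := by
    simp_rw [vecMulVec_inv_sqrt_two_smul]
    rw [← Finset.smul_sum, ← (isKrausDecomposition_iff Λ A).1 hA, smul_smul]
    simp
  have := sum_norm_le_fidelity (posSemidef_choiState Λ) isHermitian_pauliY_kronecker
    isSymm_pauliY_kronecker h
  simp_rw [norm_star_inv_sqrt_two_smul_ket] at this
  exact this

theorem exists_isKrausDecomposition_sum_norm_det_eq (Λ : QuantumChannel 2) :
    ∃ (n : ℕ) (A : Fin n → Op 2), IsKrausDecomposition Λ A ∧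
      ∑ i, ‖(A i).det‖ = fidelity (choiState Λ) (spinFlip (choiState Λ)) := by
  obtain ⟨w, hw, hF⟩ := exists_sum_norm_eq_fidelity (posSemidef_choiState Λ)
    isHermitian_pauliY_kronecker isSymm_pauliY_kronecker
  set e := Fintype.equivFin ((Fin 2 × Fin 2) ⊕ (Fin 2 × Fin 2))
  let A : Fin _ → Op 2 := fun i => Matrix.of fun a b => ((√2 : ℝ) : ℂ) * w (e.symm i) (a, b)
  have hwA : ∀ k, w k = ((√2 : ℝ) : ℂ)⁻¹ • ket (A (e k)) := by
    intro k
    ext x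
    simp [A, ket]
  refine ⟨_, A, (isKrausDecomposition_iff Λ A).2 ?_, ?_⟩
  · rw [← e.sum_comp, hw, Finset.smul_sum]
    refine Finset.sum_congr rfl fun k _ => ?_
    rw [hwA, vecMulVec_inv_sqrt_two_smul, smul_smul]
    simp
  · rw [spinFlip, ← hF, ← e.sum_comp]
    refine Finset.sum_congr rfl fun k _ => ?_
    rw [hwA, norm_star_inv_sqrt_two_smul_ket]

theorem IsKrausDecomposition.sum_trace {d n : ℕ} {Λ : QuantumChannel d} {A : Fin n → Op d}
    (hA : IsKrausDecomposition Λ A) : ∑ i, ((A i)ᴴ * A i).trace = d := by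
  have h := Λ.trace_preserving 1
  have h' := hA 1
  rw [h', Matrix.trace_sum, Matrix.trace_one] at h
  simp only [mul_one, Fintype.card_fin] at h
  rw [← h]
  exact Finset.sum_congr rfl fun i _ => Matrix.trace_mul_comm _ _

/-! ### Bounds for the sum of the squared norms -/

/-- Let `a i ≥ b i` be the singular values of `A i` and `α = ∑ a i ^ 2`, `β = ∑ b i ^ 2`,
`δ = ∑ a i * b i`, so that `α + β = 2`.  The bounds follow from `β ≤ δ ≤ α` and from the
Cauchy–Schwarz inequality `δ ^ 2 ≤ α * β = 1 - (α - 1) ^ 2`. -/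
theorem IsKrausDecomposition.sum_norm_sq_bounds {n : ℕ} {Λ : QuantumChannel 2} {A : Fin n → Op 2}
    (hA : IsKrausDecomposition Λ A) :
    1 ≤ ∑ i, ‖A i‖ ^ 2 ∧ ∑ i, ‖(A i).det‖ ≤ 1 ∧ 2 - ∑ i, ‖(A i).det‖ ≤ ∑ i, ‖A i‖ ^ 2 ∧
      ∑ i, ‖A i‖ ^ 2 ≤ 1 + √(1 - (∑ i, ‖(A i).det‖) ^ 2) := by
  choose a b hb hba hnorm htr hdet using fun i => exists_singularValues (A i)
  have h2 : ∑ i, a i ^ 2 + ∑ i, b i ^ 2 = 2 := by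
    have h := hA.sum_trace
    simp_rw [htr] at h
    rw [← Finset.sum_add_distrib]
    exact_mod_cast h
  simp_rw [hnorm, hdet]
  have h3 : ∑ i, b i ^ 2 ≤ ∑ i, a i * b i :=
    Finset.sum_le_sum fun i _ => by rw [sq]; exact mul_le_mul_of_nonneg_right (hba i) (hb i)
  have h4 : ∑ i, a i * b i ≤ ∑ i, a i ^ 2 :=
    Finset.sum_le_sum fun i _ => by
      rw [sq]; exact mul_le_mul_of_nonneg_left (hba i) ((hb i).trans (hba i))
  have h5 := Finset.sum_mul_sq_le_sq_mul_sq Finset.univ a b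
  have h0 : 0 ≤ ∑ i, a i * b i :=
    Finset.sum_nonneg fun i _ => mul_nonneg ((hb i).trans (hba i)) (hb i)
  set α := ∑ i, a i ^ 2
  set β := ∑ i, b i ^ 2
  set δ := ∑ i, a i * b i
  have hβ : β = 2 - α := by linarith
  rw [hβ] at h5 h3
  refine ⟨by linarith, by nlinarith [sq_nonneg (α - 1)], by linarith, ?_⟩
  have : α - 1 ≤ √(1 - δ ^ 2) := Real.le_sqrt_of_sq_le (by nlinarith)
  linarith

/-! ### Success probabilities -/

/-- Choosing the `i`-th network with probability proportional to `‖A i‖ ^ 2` realizes the channel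
with probability `1 / ∑ᵢ ‖A i‖ ^ 2`. -/
theorem inv_sum_norm_sq_mem_successProbabilities {d n : ℕ} {Λ : QuantumChannel d}
    {A : Fin n → Op d} (hA : IsKrausDecomposition Λ A) (h : 1 ≤ ∑ i, ‖A i‖ ^ 2) :
    1 / ∑ i, ‖A i‖ ^ 2 ∈ successProbabilities Λ := by
  set α := ∑ i, ‖A i‖ ^ 2
  have hα : 0 < α := by linarith
  refine ⟨by positivity, (div_le_one hα).2 h, n, A, fun i => (‖A i‖⁻¹ : ℝ) • A i,
    fun i => ‖A i‖ ^ 2 / α, hA, fun i => by positivity, ?_, fun i => ?_, fun i => ?_⟩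
  · rw [← Finset.sum_div, div_self hα.ne']
  · rw [norm_smul, norm_inv, norm_norm]
    exact inv_mul_le_one
  · rw [smul_smul, Real.sqrt_div (by positivity), Real.sqrt_sq (norm_nonneg _),
      Real.sqrt_div zero_le_one, Real.sqrt_one]
    rcases eq_or_ne (A i) 0 with h0 | h0
    · simp [h0]
    · have := norm_ne_zero_iff.2 h0
      congr 1
      field_simp

theorem mul_sum_norm_sq_le_one {d n : ℕ} {A A' : Fin n → Op d} {p : ℝ} {q : Fin n → ℝ}
    (hp : 0 ≤ p) (hq : ∀ i, 0 ≤ q i) (hq1 : ∑ i, q i = 1) (hA' : ∀ i, ‖A' i‖ ≤ 1)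
    (h : ∀ i, √(q i) • A' i = √p • A i) : p * ∑ i, ‖A i‖ ^ 2 ≤ 1 := by
  rw [← hq1, Finset.mul_sum]
  refine Finset.sum_le_sum fun i _ => ?_
  have h1 := congrArg (fun X => ‖X‖ ^ 2) (h i)
  simp only [norm_smul, mul_pow, Real.norm_eq_abs, sq_abs, Real.sq_sqrt hp,
    Real.sq_sqrt (hq i)] at h1
  rw [← h1]
  exact mul_le_of_le_one_right (hq i) (pow_le_one₀ (norm_nonneg _) (hA' i))

/-- The convex hull of the Choi matrices `|A⟩⟩⟨⟨A|` of single admissible Kraus operators.  A positive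
`p ≤ 1` is a success probability of `Λ` iff `p` times the unnormalized Choi matrix of `Λ` lies in
it. -/
def admissibleHull (d : ℕ) : Set (Matrix (Fin d × Fin d) (Fin d × Fin d) ℂ) :=
  convexHull ℝ ((fun A : Op d => Matrix.vecMulVec (ket A) (star (ket A))) '' Metric.closedBall 0 1)

theorem isCompact_admissibleHull (d : ℕ) : IsCompact (admissibleHull d) := by
  refine isCompact_convexHull_of_finiteDimensional ((isCompact_closedBall 0 1).image ?_)
  refine continuous_matrix fun x y => ?_
  simp only [Matrix.vecMulVec_apply, ket, Pi.star_apply]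
  exact (continuous_id.matrix_elem _ _).mul (continuous_id.matrix_elem _ _).star

theorem vecMulVec_ket_real_smul {d : ℕ} (r : ℝ) (A : Op d) :
    Matrix.vecMulVec (ket (r • A)) (star (ket (r • A))) =
      (r ^ 2) • Matrix.vecMulVec (ket A) (star (ket A)) := by
  ext x y
  simp [Matrix.vecMulVec_apply, ket]
  ring

theorem smul_choiState_mem_admissibleHull {d : ℕ} {Λ : QuantumChannel d} {p : ℝ}
    (hp : p ∈ successProbabilities Λ) : p • ((d : ℂ) • choiState Λ) ∈ admissibleHull d := by
  obtain ⟨hp0, -, n, A, A', q, hA, hq, hq1, hA', h⟩ := hp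
  have : p • ((d : ℂ) • choiState Λ) =
      ∑ i, q i • Matrix.vecMulVec (ket (A' i)) (star (ket (A' i))) := by
    rw [(isKrausDecomposition_iff Λ A).1 hA, Finset.smul_sum]
    refine Finset.sum_congr rfl fun i _ => ?_
    conv_lhs => rw [← Real.sq_sqrt hp0]
    rw [← vecMulVec_ket_real_smul, ← h i, vecMulVec_ket_real_smul, Real.sq_sqrt (hq i)]
  rw [this]
  exact (convex_convexHull ℝ _).sum_mem (fun i _ => hq i) hq1 fun i _ =>
    subset_convexHull ℝ _ ⟨A' i, by simpa using hA' i, rfl⟩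

theorem mem_successProbabilities_of_smul_choiState_mem {d : ℕ} {Λ : QuantumChannel d} {p : ℝ}
    (hp : 0 < p) (hp1 : p ≤ 1) (h : p • ((d : ℂ) • choiState Λ) ∈ admissibleHull d) :
    p ∈ successProbabilities Λ := by
  obtain ⟨ι, _, q, v, hq, hq1, hv, hsum⟩ := mem_convexHull_iff_exists_fintype.1 h
  choose A' hA' hA'v using hv
  set e := Fintype.equivFin ι
  refine ⟨hp.le, hp1, _, fun i => √(q (e.symm i) / p) • A' (e.symm i), fun i => A' (e.symm i),
    fun i => q (e.symm i), (isKrausDecomposition_iff Λ _).2 ?_, fun i => hq _, ?_,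
    fun i => by simpa using hA' (e.symm i), fun i => ?_⟩
  · rw [e.symm.sum_comp (fun k => Matrix.vecMulVec (ket (√(q k / p) • A' k))
      (star (ket (√(q k / p) • A' k)))), ← inv_smul_smul₀ hp.ne' ((d : ℂ) • choiState Λ), ← hsum,
      Finset.smul_sum]
    refine Finset.sum_congr rfl fun k _ => ?_
    rw [vecMulVec_ket_real_smul, Real.sq_sqrt (div_nonneg (hq k) hp.le), ← hA'v k, smul_smul,
      inv_mul_eq_div]
  · rwa [e.symm.sum_comp]
  · rw [smul_smul, ← Real.sqrt_mul hp.le, mul_div_cancel₀ _ hp.ne']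

/-- The maximum is attained as `admissibleHull d` is compact.  A positive success probability is
assumed because membership in the hull says nothing about the existence of a Kraus decomposition
at `p = 0`. -/
theorem isGreatest_pSucc {d : ℕ} {Λ : QuantumChannel d} {p₀ : ℝ} (hp₀ : 0 < p₀)
    (hmem : p₀ ∈ successProbabilities Λ) : IsGreatest (successProbabilities Λ) (pSucc Λ) := by
  set K := Set.Icc (0 : ℝ) 1 ∩ (fun p : ℝ => p • ((d : ℂ) • choiState Λ)) ⁻¹' admissibleHull d
  have hK : IsCompact K := isCompact_Icc.inter_right
    ((isCompact_admissibleHull d).isClosed.preimage (by fun_prop))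
  have hsub : successProbabilities Λ ⊆ K := fun p hp =>
    ⟨⟨hp.1, hp.2.1⟩, smul_choiState_mem_admissibleHull hp⟩
  obtain ⟨p, hpK, hp⟩ := hK.exists_isGreatest ⟨p₀, hsub hmem⟩
  have h : IsGreatest (successProbabilities Λ) p :=
    ⟨mem_successProbabilities_of_smul_choiState_mem (hp₀.trans_le (hp (hsub hmem))) hpK.1.2 hpK.2,
      fun r hr => hp (hsub hr)⟩
  rwa [pSucc, h.csSup_eq]

end ChannelRealization

end

theorem theorem2 (Λ : ChannelRealization.QuantumChannel 2) (F : ℝ)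
    (hF : F = ChannelRealization.fidelity (ChannelRealization.choiState Λ)
      (ChannelRealization.spinFlip (ChannelRealization.choiState Λ))) :
    -- the optimal probability of success is attained (it is a maximum)
    IsGreatest (ChannelRealization.successProbabilities Λ) (ChannelRealization.pSucc Λ) ∧
    ChannelRealization.pSucc Λ ≤ 1 / (2 - F) ∧
    1 / (1 + √(1 - F ^ 2)) ≤ ChannelRealization.pSucc Λ := by
  -- a Kraus decomposition that is optimal for the concurrence of assistance
  obtain ⟨n, A, hA, hAF⟩ :=
    ChannelRealization.exists_isKrausDecomposition_sum_norm_det_eq Λ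
  rw [← hF] at hAF
  obtain ⟨h1, hF1, -, hle⟩ := hA.sum_norm_sq_bounds
  rw [hAF] at hF1 hle
  have hmem := ChannelRealization.inv_sum_norm_sq_mem_successProbabilities hA h1
  have hgr := ChannelRealization.isGreatest_pSucc (by positivity) hmem
  refine ⟨hgr, ?_, le_trans ?_ (hgr.2 hmem)⟩
  · obtain ⟨hp0, -, k, B, B', q, hB, hq, hq1, hB', h⟩ := hgr.1
    have hBF := hB.sum_norm_det_le
    rw [← hF] at hBF
    have hlow := hB.sum_norm_sq_bounds.2.2.1
    rw [le_div_iff₀ (by linarith)]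
    refine le_trans ?_ (ChannelRealization.mul_sum_norm_sq_le_one hp0 hq hq1 hB' h)
    exact mul_le_mul_of_nonneg_left (by linarith) hp0
  · exact one_div_le_one_div_of_le (by linarith) hle
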